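/- Let $\{t_n\}_{n\ge 0}$ be the integer sequence given by $t_0=1$, $t_1=5$ and $t_{n+1}=(8n^2+12n+5)\,t_n-4n^2(2n+1)^2\,t_{n-1}$ for $n\ge 1$, and let $\{B_n\}_{n\ge 0}$ be the Bernoulli numbers given by $B_0=1$ and $\sum_{k=0}^{n-1}\binom nk B_k=0$ for $n\ge 2$. For a prime $p$, an integer $k\ge 1$ and rational numbers $x,y$, write $x\equiv y\pmod{p^k}$ if $(x-y)/p^k$ is a rational number whose denominator in lowest terms is not divisible by $p$. **Theorem 3.3.** Let $p$ be an odd prime. Then - $t_p\equiv \bigl(1+4(-1)^{(p-1)/2}\bigr)p^2 \pmod{p^3}$; - $t_{p-1}\equiv (-1)^{(p-1)/2}\bigl(2p+2^p-2+(pB_{p-1})^2\bigr)\pmod{p^2}$; - $t_{(p-1)/2}\equiv pB_{p-1}-p+2^{p-1}-1\pmod{p^2}$; - $t_{(p+1)/2}\equiv pB_{p-1}-3p+2^{p-1}-1\pmod{p^2}$; - if $p\equiv 3\pmod 4$, then $t_{(p-3)/4}\equiv \dfrac{1}{\binom{(p-1)/2}{(p-3)/4}}\pmod p$ or $t_{(p-3)/4}\equiv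 -\dfrac{1}{\binom{(p-1)/2}{(p-3)/4}}\pmod p$. -/

import Mathlib

/-- The integer sequence with `t 0 = 1`, `t 1 = 5` and
`t (m + 1) = (8 m ^ 2 + 12 m + 5) t m - 4 m ^ 2 (2 m + 1) ^ 2 t (m - 1)` for `m ≥ 1`
(written here with `m = n + 1`). -/
def tSeq : ℕ → ℤ
  | 0 => 1
  | 1 => 5
  | n + 2 =>
    (8 * ((n : ℤ) + 1) ^ 2 + 12 * ((n : ℤ) + 1) + 5) * tSeq (n + 1)
      - 4 * ((n : ℤ) + 1) ^ 2 * (2 * ((n : ℤ) + 1) + 1) ^ 2 * tSeq n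

/-- Congruence `x ≡ y (mod p ^ k)` of rational numbers: the difference `x - y` is `p ^ k` times
a rational number whose (reduced) denominator is not divisible by `p`. -/
def RatModEq (p k : ℕ) (x y : ℚ) : Prop :=
  ∃ z : ℚ, ¬ p ∣ z.den ∧ x - y = (p : ℚ) ^ k * z

open Finset

/-! The recurrence drops to first order (`tSeq_succ`), so t_n = 4^n n!² Σ_{k≤n} (1·3⋯(2k-1))² / (4^k
k!²). Let p = 2m+1. Modulo p², (2j+1)² may be replaced by (2j+1)² - p², which turns the summand into
(-1)^k C(m,k) C(m+k,m). Its full sum is a Legendre value (-1)^m, so t_n ≡ (-1)^m 4^n n!² for n ≥ m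
(`tSeq_modEq_of_le`). The first four claims follow from Wilson's theorem, (2m)! ≡ (-1)^m m!² (2·4^m
- 1) (`factorial_two_mul_modEq`) and pB_{p-1} ≡ (p-1)! + p, both modulo p². For the last claim the
summand is C(m,k)² modulo p, and n = (p-3)/4 takes exactly half of Σ C(m,k)² = C(2m,m). -/

/-! ### First-order recurrence and sum form. -/

/-- The product of the first `n` odd numbers. -/
def oddProd (n : ℕ) : ℤ := ∏ j ∈ range n, (2 * (j : ℤ) + 1)

theorem oddProd_succ (n : ℕ) : oddProd (n + 1) = oddProd n * (2 * n + 1) := by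
  simp [oddProd, prod_range_succ]

/-- The second-order recurrence factors: it multiplies t_{n+1} - 4(n+1)² t_n by (2n+3)² when n
increases by one. -/
theorem tSeq_succ (n : ℕ) :
    tSeq (n + 1) = 4 * ((n : ℤ) + 1) ^ 2 * tSeq n + oddProd (n + 1) ^ 2 := by
  induction n with
  | zero => simp [tSeq, oddProd]
  | succ n ih =>
    rw [oddProd_succ (n + 1), tSeq]
    push_cast
    linear_combination (2 * ((n : ℤ) + 1) + 1) ^ 2 * ih

/-- A sequence satisfying `tSeq_succ` modulo `N` with summand given in product form agrees with
`tSeq` modulo `N`. -/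
theorem tSeq_modEq_sum {N : ℤ} {c : ℕ → ℤ}
    (h : ∀ n, 4 ^ n * (n.factorial : ℤ) ^ 2 * c n ≡ oddProd n ^ 2 [ZMOD N]) (n : ℕ) :
    tSeq n ≡ 4 ^ n * (n.factorial : ℤ) ^ 2 * ∑ k ∈ range (n + 1), c k [ZMOD N] := by
  induction n with
  | zero => simpa [tSeq, oddProd] using (h 0).symm
  | succ n ih =>
    rw [tSeq_succ, sum_range_succ, mul_add]
    refine Int.ModEq.add ?_ (h (n + 1)).symm
    refine (ih.mul_left _).trans (congrArg (· % _) ?_)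
    rw [Nat.factorial_succ]
    push_cast
    ring

/-! ### Values modulo (2m+1)² from index m on. -/

theorem cast_choose_succ_mul (m n : ℕ) :
    (m.choose (n + 1) : ℤ) * (n + 1) = m.choose n * (m - n) := by
  rcases le_or_gt n m with h | h
  · have := Nat.choose_succ_right_eq m n
    zify [h] at this
    exact this
  · simp [Nat.choose_eq_zero_of_lt h, Nat.choose_eq_zero_of_lt (h.trans (Nat.lt_succ_self n))]

/-- Consecutive terms differ by the factor -4(m-n)(m+n+1) = (2n+1)² - (2m+1)². -/
theorem four_pow_mul_factorial_sq_mul_choose (m n : ℕ) :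
    4 ^ n * (n.factorial : ℤ) ^ 2 * ((-1) ^ n * m.choose n * (m + n).choose m) =
      ∏ j ∈ range n, ((2 * (j : ℤ) + 1) ^ 2 - (2 * m + 1) ^ 2) := by
  induction n with
  | zero => simp
  | succ n ih =>
    rw [prod_range_succ, ← ih, Nat.factorial_succ]
    have h1 := cast_choose_succ_mul m n
    have h2 : ((m + (n + 1)).choose m : ℤ) * (n + 1) = (m + n).choose m * (m + n + 1) := by
      have := Nat.add_one_mul_choose_eq (m + n) n
      rw [add_assoc m n 1, ← Nat.choose_symm_add, ← Nat.choose_symm_add] at this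
      zify at this
      linear_combination -this
    push_cast
    linear_combination (-(4 : ℤ) ^ (n + 1) * (n.factorial : ℤ) ^ 2 * (-1) ^ n) *
      ((m + (n + 1)).choose m * (n + 1) * h1 + (m.choose n * (m - n)) * h2)

/-- The sum is the shifted Legendre polynomial at 1; the symmetry x ↦ 1-x reduces it to the constant
coefficient. -/
theorem sum_neg_one_pow_mul_choose_mul_choose (m : ℕ) :
    ∑ k ∈ range (m + 1), ((-1 : ℤ) ^ k * m.choose k * (m + k).choose m) = (-1) ^ m := by
  have h := Polynomial.shiftedLegendre_eval_symm m (1 : ℤ)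
  rw [sub_self, ← Polynomial.coeff_zero_eq_aeval_zero', Polynomial.coeff_shiftedLegendre] at h
  simpa [Polynomial.shiftedLegendre] using h

theorem prod_sq_sub_modEq_oddProd_sq (q : ℤ) (n : ℕ) :
    ∏ j ∈ range n, ((2 * (j : ℤ) + 1) ^ 2 - q ^ 2) ≡ oddProd n ^ 2 [ZMOD q ^ 2] := by
  rw [oddProd, ← prod_pow]
  refine Int.ModEq.prod fun j _ => ?_
  exact (Int.modEq_iff_dvd.2 ⟨1, by ring⟩)

theorem tSeq_modEq_of_le {m n : ℕ} (h : m ≤ n) :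
    tSeq n ≡ 4 ^ n * (n.factorial : ℤ) ^ 2 * (-1) ^ m [ZMOD (2 * (m : ℤ) + 1) ^ 2] := by
  refine (tSeq_modEq_sum (c := fun k => (-1) ^ k * m.choose k * (m + k).choose m)
    (fun k => ?_) n).trans (congrArg (· % _) ?_)
  · rw [four_pow_mul_factorial_sq_mul_choose]
    exact prod_sq_sub_modEq_oddProd_sq _ _
  · rw [← sum_neg_one_pow_mul_choose_mul_choose]
    congr 1
    symm
    -- Terms with k > m vanish, so any n ≥ m gives the full sum.
    refine sum_subset (range_mono (by omega)) fun k _ hk => ?_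
    rw [Nat.choose_eq_zero_of_lt (n := m) (k := k) (by simpa using hk)]
    simp

/-! ### Factorial and power sum modulo p². -/

theorem prod_one_add_mul_modEq {ι : Type*} (q : ℤ) (f : ι → ℤ) (s : Finset ι) :
    ∏ i ∈ s, (1 + q * f i) ≡ 1 + q * ∑ i ∈ s, f i [ZMOD q ^ 2] := by
  classical
  induction s using Finset.induction_on with
  | empty => simp
  | insert a s ha ih =>
    rw [prod_insert ha, sum_insert ha]
    refine (ih.mul_left _).trans (Int.modEq_iff_dvd.2 ⟨-(f a * ∑ i ∈ s, f i), by ring⟩)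

theorem cast_factorial_eq_prod (n : ℕ) : (n.factorial : ℤ) = ∏ j ∈ range n, ((j : ℤ) + 1) := by
  rw [← prod_range_add_one_eq_factorial]
  push_cast
  rfl

theorem factorial_pred_modEq_neg_one {p : ℕ} (hp : p.Prime) :
    ((p - 1).factorial : ℤ) ≡ -1 [ZMOD p] := by
  have := Fact.mk hp
  rw [← ZMod.intCast_eq_intCast_iff]
  simp

/-- With a^{p-1} = 1 + p q_a and (p-1)! = -1 + pk, expanding ((p-1)!)^{p-1} in two ways gives k ≡ Σ
q_a modulo p. -/
theorem factorial_pred_add_prime_modEq_sum_pow {p : ℕ} (hp : p.Prime) (hodd : Odd p) :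
    ((p - 1).factorial : ℤ) + p ≡ ∑ j ∈ range (p - 1), ((j : ℤ) + 1) ^ (p - 1)
      [ZMOD (p : ℤ) ^ 2] := by
  obtain ⟨m, hm⟩ := hodd
  have hpm : p - 1 = 2 * m := by omega
  have hq : ∀ j : ℕ, ∃ q : ℤ, j ∈ range (p - 1) → ((j : ℤ) + 1) ^ (p - 1) = 1 + p * q := by
    intro j
    by_cases hj : j ∈ range (p - 1)
    · have hcop : IsCoprime ((j : ℤ) + 1) p := by
        have : Nat.Coprime (j + 1) p :=
          (Nat.coprime_of_lt_prime (by omega) (by simp at hj; omega) hp).symm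
        exact_mod_cast Nat.isCoprime_iff_coprime.2 this
      obtain ⟨q, h⟩ := (Int.ModEq.pow_card_sub_one_eq_one hp hcop).symm.dvd
      exact ⟨q, fun _ => by linarith⟩
    · exact ⟨0, fun h => absurd h hj⟩
  choose q hq using hq
  obtain ⟨k, hk⟩ := (factorial_pred_modEq_neg_one hp).symm.dvd
  have hw : ((p - 1).factorial : ℤ) = -1 + p * k := by linarith
  have h1 : ((p - 1).factorial : ℤ) ^ (p - 1) ≡ 1 + p * ∑ j ∈ range (p - 1), q j
      [ZMOD (p : ℤ) ^ 2] := by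
    rw [cast_factorial_eq_prod, ← prod_pow, prod_congr rfl hq]
    exact prod_one_add_mul_modEq _ _ _
  have h2 : ((p - 1).factorial : ℤ) ^ (p - 1) ≡ 1 + p * k [ZMOD (p : ℤ) ^ 2] := by
    have := prod_one_add_mul_modEq (p : ℤ) (fun _ => -2 * k + p * k ^ 2) (range m)
    rw [prod_const, sum_const, card_range, nsmul_eq_mul] at this
    rw [hw, hpm, pow_mul]
    have e : (-1 + (p : ℤ) * k) ^ 2 = 1 + p * (-2 * k + p * k ^ 2) := by ring
    rw [e]
    -- As 2m = p - 1, the linear term -2mkp is kp modulo p².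
    refine this.trans (Int.modEq_iff_dvd.2 ⟨k - m * k ^ 2, ?_⟩)
    have : (p : ℤ) = 2 * m + 1 := by exact_mod_cast hm
    linear_combination (-(p : ℤ) * k) * this
  rw [sum_congr rfl hq, sum_add_distrib, ← mul_sum, hw]
  have h3 := (h2.symm.trans h1).add_right ((p : ℤ) - 2)
  have hc : ∑ _j ∈ range (p - 1), (1 : ℤ) = p - 1 := by
    simp [Nat.cast_sub hp.one_le]
  rw [hc]
  have a1 : -1 + (p : ℤ) * k + p = 1 + p * k + (p - 2) := by ring
  have a2 : (p : ℤ) - 1 + p * ∑ j ∈ range (p - 1), q j =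
      1 + p * ∑ j ∈ range (p - 1), q j + (p - 2) := by ring
  rw [a1, a2]
  exact h3

/-! ### Integrality at p and Bernoulli numbers. -/

/-- The rational numbers whose denominator is prime to `p`. -/
def integralAt (p : ℕ) (hp : p.Prime) : Subring ℚ where
  carrier := {z | ¬ p ∣ z.den}
  mul_mem' {a b} ha hb h := by
    rcases (hp.dvd_mul.1 (h.trans (Rat.mul_den_dvd a b))) with h | h
    exacts [ha h, hb h]
  one_mem' := by simpa using hp.ne_one
  add_mem' {a b} ha hb h := by
    rcases (hp.dvd_mul.1 (h.trans (Rat.add_den_dvd a b))) with h | h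
    exacts [ha h, hb h]
  zero_mem' := by simpa using hp.ne_one
  neg_mem' {a} ha := by simpa using ha

theorem inv_natCast_mem_integralAt {p : ℕ} (hp : p.Prime) {a : ℕ} (ha : ¬ p ∣ a) :
    (a : ℚ)⁻¹ ∈ integralAt p hp := by
  have ha0 : a ≠ 0 := by rintro rfl; simp at ha
  change ¬ p ∣ (a : ℚ)⁻¹.den
  rwa [Rat.inv_natCast_den_of_pos (Nat.pos_of_ne_zero ha0)]

theorem ratModEq_iff {p : ℕ} (hp : p.Prime) {k : ℕ} {x y : ℚ} :
    RatModEq p k x y ↔ ∃ z ∈ integralAt p hp, x - y = (p : ℚ) ^ k * z := Iff.rfl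

theorem RatModEq.of_int {p : ℕ} (hp : p.Prime) {k : ℕ} {x y : ℤ}
    (h : x ≡ y [ZMOD (p : ℤ) ^ k]) : RatModEq p k x y := by
  obtain ⟨c, hc⟩ := h.symm.dvd
  refine (ratModEq_iff hp).2 ⟨c, intCast_mem _ c, ?_⟩
  exact_mod_cast hc

theorem RatModEq.trans {p : ℕ} (hp : p.Prime) {k : ℕ} {x y z : ℚ} (h : RatModEq p k x y)
    (h' : RatModEq p k y z) : RatModEq p k x z := by
  obtain ⟨a, ha, h⟩ := (ratModEq_iff hp).1 h
  obtain ⟨b, hb, h'⟩ := (ratModEq_iff hp).1 h'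
  exact (ratModEq_iff hp).2 ⟨a + b, add_mem ha hb, by linear_combination h + h'⟩

/-- The recursion only divides by integers n-k+1 ≤ n+1 < p. -/
theorem bernoulli'_mem_integralAt {p : ℕ} (hp : p.Prime) (n : ℕ) (hn : n + 1 < p) :
    bernoulli' n ∈ integralAt p hp := by
  induction n using Nat.strong_induction_on with
  | _ n ih =>
    rw [bernoulli'_def]
    refine sub_mem (one_mem _) (sum_mem fun k hk => ?_)
    have hk := mem_range.1 hk
    refine mul_mem ?_ (ih k hk (by omega))
    have : ((n : ℚ) - k + 1) = ((n - k + 1 : ℕ) : ℚ) := by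
      push_cast [Nat.cast_sub hk.le]; ring
    rw [this, div_eq_mul_inv]
    exact mul_mem (natCast_mem _ _)
      (inv_natCast_mem_integralAt hp (Nat.not_dvd_of_pos_of_lt (by omega) (by omega)))

theorem bernoulli_mem_integralAt {p : ℕ} (hp : p.Prime) (n : ℕ) (hn : n + 1 < p) :
    bernoulli n ∈ integralAt p hp :=
  mul_mem (pow_mem (neg_mem (one_mem _)) _) (bernoulli'_mem_integralAt hp n hn)

/-- In Faulhaber's formula the term i = p-1 is pB_{p-1}. The others carry p²: for 0 < i < p-1
because p ∣ C(p,i) and p-i ≥ 2, for i = 0 because the term is p^{p-1} with p ≥ 3. -/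
theorem sum_pow_ratModEq_mul_bernoulli {p : ℕ} (hp : p.Prime) (hodd : Odd p) :
    RatModEq p 2 (∑ j ∈ range (p - 1), ((j : ℤ) + 1) ^ (p - 1) : ℤ) (p * bernoulli (p - 1)) := by
  have hp3 : 3 ≤ p := by
    have := hp.two_le
    obtain ⟨m, hm⟩ := hodd
    omega
  have hp0 : (p : ℚ) ≠ 0 := by exact_mod_cast hp.ne_zero
  have hpp : p - 1 + 1 = p := by omega
  have hS : ((∑ j ∈ range (p - 1), ((j : ℤ) + 1) ^ (p - 1) : ℤ) : ℚ) =
      ∑ k ∈ range p, (k : ℚ) ^ (p - 1) := by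
    conv_rhs => rw [← hpp]
    rw [sum_range_succ']
    simp [show p - 1 ≠ 0 by omega]
  rw [hS, sum_range_pow, sum_range_succ, hpp]
  have hcast : ((p - 1 : ℕ) : ℚ) + 1 = p := by exact_mod_cast hpp
  have key : ∀ i : ℕ, ∃ z ∈ integralAt p hp, i ∈ range (p - 1) →
      bernoulli i * (p.choose i) * (p : ℚ) ^ (p - i) / p = (p : ℚ) ^ 2 * z := by
    intro i
    by_cases hi : i ∈ range (p - 1)
    · have hi' := mem_range.1 hi
      have hB := bernoulli_mem_integralAt hp i (by omega)
      rcases Nat.eq_zero_or_pos i with rfl | hpos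
      · refine ⟨(p : ℚ) ^ (p - 3), pow_mem (natCast_mem _ _) _, fun _ => ?_⟩
        obtain ⟨r, rfl⟩ := Nat.exists_eq_add_of_le hp3
        rw [bernoulli_zero, Nat.choose_zero_right, Nat.sub_zero, add_tsub_cancel_left]
        field_simp
        ring
      · obtain ⟨c, hc⟩ := hp.dvd_choose_self hpos.ne' (show i < p by omega)
        refine ⟨bernoulli i * c * (p : ℚ) ^ (p - i - 2),
          mul_mem (mul_mem hB (natCast_mem _ _)) (pow_mem (natCast_mem _ _) _), fun _ => ?_⟩
        obtain ⟨r, hr⟩ := Nat.exists_eq_add_of_le (show 2 ≤ p - i by omega)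
        rw [hc, hr, add_tsub_cancel_left]
        push_cast
        field_simp
        ring
    · exact ⟨0, zero_mem _, fun h => absurd h hi⟩
  choose z hz hzeq using key
  refine (ratModEq_iff hp).2 ⟨∑ i ∈ range (p - 1), z i, sum_mem fun i _ => hz i, ?_⟩
  have hch : p.choose (p - 1) = p := by
    conv_lhs => rw [← hpp, add_tsub_cancel_right]
    rw [Nat.choose_succ_self_right, hpp]
  rw [hcast, sum_congr rfl hzeq, ← mul_sum, hch, show p - (p - 1) = 1 by omega, pow_one]
  field_simp
  ring

/-! ### Comparing (2m)! with m!² modulo p². -/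

/-- The point is that s does not depend on a, so two values of a eliminate it. The leading factor a
avoids the exponent m-1. -/
theorem prod_sub_mul_modEq (q : ℤ) (m : ℕ) :
    ∃ s : ℤ, ∀ a : ℤ, a * ∏ j ∈ range m, (q - a * ((j : ℤ) + 1)) ≡
      (-1) ^ m * (a ^ (m + 1) * m.factorial - q * a ^ m * s) [ZMOD q ^ 2] := by
  induction m with
  | zero => exact ⟨0, fun a => by simp⟩
  | succ m ih =>
    obtain ⟨s, hs⟩ := ih
    refine ⟨s * (m + 1) + m.factorial, fun a => ?_⟩
    rw [prod_range_succ, ← mul_assoc, Nat.factorial_succ]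
    refine ((hs a).mul_right _).trans (Int.modEq_iff_dvd.2 ⟨(-1) ^ m * a ^ m * s, ?_⟩)
    push_cast
    ring

theorem factorial_two_mul (m : ℕ) :
    ((2 * m).factorial : ℤ) = 2 ^ m * m.factorial * oddProd m := by
  induction m with
  | zero => simp [oddProd]
  | succ m ih =>
    rw [oddProd_succ, mul_add_one, Nat.factorial_succ, Nat.factorial_succ, Nat.factorial_succ]
    push_cast
    rw [ih]
    ring

theorem oddProd_eq_prod_sub (m : ℕ) :
    oddProd m = ∏ j ∈ range m, ((2 * m + 1 : ℤ) - 2 * ((j : ℤ) + 1)) := by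
  rw [oddProd, ← prod_range_reflect]
  refine prod_congr rfl fun j hj => ?_
  have := mem_range.1 hj
  rw [Nat.cast_sub (by omega), Nat.cast_sub (by omega)]
  push_cast
  ring

theorem factorial_two_mul_eq_prod_sub (m : ℕ) :
    ((2 * m).factorial : ℤ) =
      m.factorial * ∏ j ∈ range m, ((2 * m + 1 : ℤ) - 1 * ((j : ℤ) + 1)) := by
  have h := Nat.factorial_mul_descFactorial (show m ≤ 2 * m by omega)
  rw [Nat.descFactorial_eq_prod_range, show 2 * m - m = m by omega] at h
  rw [← h, Nat.cast_mul, Nat.cast_prod]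
  congr 1
  refine prod_congr rfl fun j hj => ?_
  have := mem_range.1 hj
  rw [Nat.cast_sub (by omega)]
  push_cast
  ring

theorem isCoprime_factorial {m : ℕ} (hp : (2 * m + 1).Prime) :
    IsCoprime (m.factorial : ℤ) (2 * m + 1) := by
  have := (Nat.Prime.coprime_iff_not_dvd hp).2
    (fun h => absurd ((hp.dvd_factorial).1 h) (by omega : ¬ 2 * m + 1 ≤ m))
  exact_mod_cast Nat.isCoprime_iff_coprime.2 this.symm

theorem exists_four_pow_eq {m : ℕ} (hp : (2 * m + 1).Prime) :
    ∃ b : ℤ, 4 ^ m = 1 + (2 * (m : ℤ) + 1) * b := by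
  have hm : m ≠ 0 := by rintro rfl; simp [Nat.not_prime_one] at hp
  have hcop : IsCoprime (2 : ℤ) ((2 * m + 1 : ℕ) : ℤ) := by
    have : Nat.Coprime 2 (2 * m + 1) := by simp
    exact_mod_cast Nat.isCoprime_iff_coprime.2 this
  obtain ⟨b, h⟩ := (Int.ModEq.pow_card_sub_one_eq_one hp hcop).symm.dvd
  rw [add_tsub_cancel_right, pow_mul] at h
  push_cast at h
  exact ⟨b, by linear_combination h⟩

/-- Both a = 1 (upper half of the factorial) and a = 2 (its odd factors) express (2m)!; comparing
them determines s modulo p through the Fermat quotient b of 2. -/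
theorem factorial_two_mul_modEq {m : ℕ} (hp : (2 * m + 1).Prime) :
    ((2 * m).factorial : ℤ) ≡ (-1) ^ m * (m.factorial : ℤ) ^ 2 * (2 * 4 ^ m - 1)
      [ZMOD (2 * (m : ℤ) + 1) ^ 2] := by
  obtain ⟨s, hs⟩ := prod_sub_mul_modEq (2 * (m : ℤ) + 1) m
  obtain ⟨b, hb⟩ := exists_four_pow_eq hp
  have h1 := (hs 1).mul_left (m.factorial : ℤ)
  have h2 := (hs 2).mul_left (2 ^ m * (m.factorial : ℤ))
  rw [one_mul, ← factorial_two_mul_eq_prod_sub] at h1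
  rw [← oddProd_eq_prod_sub, mul_left_comm, ← factorial_two_mul] at h2
  have h4 : (2 : ℤ) ^ m * 2 ^ m = 4 ^ m := by rw [← mul_pow]; norm_num
  have hsq : ((-1 : ℤ) ^ m) * (-1) ^ m = 1 := by rw [← mul_pow]; norm_num
  obtain ⟨u, hu⟩ := h1.dvd
  obtain ⟨v, hv⟩ := h2.dvd
  simp only [one_pow, one_mul, mul_one] at hu
  set q : ℤ := 2 * (m : ℤ) + 1 with hq
  set M : ℤ := (m.factorial : ℤ)
  set F : ℤ := ((2 * m).factorial : ℤ)
  have hdvd : q ^ 2 ∣ M * (2 * q * b * M + q * s) := by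
    refine ⟨(-1) ^ m * (v - 2 * u) + M * b * s, ?_⟩
    have hv' : (-1) ^ m * M * (2 * 4 ^ m * M - q * 4 ^ m * s) - 2 * F = q ^ 2 * v := by
      rw [← hv, ← h4]; ring
    rw [hb] at hv'
    linear_combination (-1) ^ m * (hv' - 2 * hu) +
      (-(M * (2 * q * b * M + q * s)) + q ^ 2 * M * b * s) * hsq
  have hcop : IsCoprime (q ^ 2) M := (isCoprime_factorial hp).symm.pow_left
  obtain ⟨w, hw⟩ := hcop.dvd_of_dvd_mul_left hdvd
  refine Int.modEq_iff_dvd.2 ⟨u + (-1) ^ m * M * w, ?_⟩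
  rw [hb]
  linear_combination hu + (-1) ^ m * M * hw

/-! ### The values at (p-1)/2, p-1, (p+1)/2 and p. -/

theorem tSeq_half_modEq {m : ℕ} (hp : (2 * m + 1).Prime) :
    tSeq m ≡ (2 * m).factorial + 4 ^ m - 1 [ZMOD (2 * (m : ℤ) + 1) ^ 2] := by
  refine (tSeq_modEq_of_le le_rfl).trans ?_
  obtain ⟨b, hb⟩ := exists_four_pow_eq hp
  obtain ⟨k, hk⟩ := (factorial_pred_modEq_neg_one hp).symm.dvd
  obtain ⟨u, hu⟩ := (factorial_two_mul_modEq hp).dvd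
  rw [add_tsub_cancel_right] at hk
  push_cast at hk
  rw [hb] at hu ⊢
  set q : ℤ := 2 * (m : ℤ) + 1
  refine Int.modEq_iff_dvd.2 ⟨b * k - u * (1 - q * b) -
    2 * (-1) ^ m * (m.factorial : ℤ) ^ 2 * b ^ 2, ?_⟩
  -- Multiplying (2m)! ≡ (-1)^m m!² (1+2qb) by 1-qb leaves (-1)^m m!² (1+qb), and (2m)! ≡ -1 modulo
  -- q.
  linear_combination q * b * hk - (1 - q * b) * hu

theorem tSeq_two_mul_modEq {m : ℕ} (hp : (2 * m + 1).Prime) :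
    tSeq (2 * m) ≡ (-1) ^ m * (2 * (2 * m + 1) + 2 * 4 ^ m - 2 +
      ((2 * m).factorial + (2 * (m : ℤ) + 1)) ^ 2) [ZMOD (2 * (m : ℤ) + 1) ^ 2] := by
  refine (tSeq_modEq_of_le (show m ≤ 2 * m by omega)).trans ?_
  obtain ⟨b, hb⟩ := exists_four_pow_eq hp
  obtain ⟨k, hk⟩ := (factorial_pred_modEq_neg_one hp).symm.dvd
  rw [add_tsub_cancel_right] at hk
  push_cast at hk
  have hF : ((2 * m).factorial : ℤ) = -1 + (2 * (m : ℤ) + 1) * k := by linear_combination hk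
  rw [two_mul m, pow_add, ← two_mul, hF, hb]
  set q : ℤ := 2 * (m : ℤ) + 1
  refine Int.modEq_iff_dvd.2 ⟨(-1) ^ m * (2 * k + 1 - b ^ 2 * (-1 + q * k) ^ 2 +
    2 * b * (2 * k - q * k ^ 2)), ?_⟩
  ring

theorem two_mul_add_one_dvd_oddProd_succ (m : ℕ) : 2 * (m : ℤ) + 1 ∣ oddProd (m + 1) := by
  rw [oddProd_succ]
  exact dvd_mul_left _ _

/-- The odd product contains p, so its square drops out; 4(m+1)² = (p+1)² ≡ 1+2p and t_m ≡ -1 modulo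
p. -/
theorem tSeq_half_succ_modEq {m : ℕ} (hp : (2 * m + 1).Prime) :
    tSeq (m + 1) ≡ (2 * m).factorial + 4 ^ m - 1 - 2 * (2 * m + 1)
      [ZMOD (2 * (m : ℤ) + 1) ^ 2] := by
  obtain ⟨b, hb⟩ := exists_four_pow_eq hp
  obtain ⟨k, hk⟩ := (factorial_pred_modEq_neg_one hp).symm.dvd
  obtain ⟨u, hu⟩ := (tSeq_half_modEq hp).dvd
  obtain ⟨d, hd⟩ := two_mul_add_one_dvd_oddProd_succ m
  rw [add_tsub_cancel_right] at hk
  push_cast at hk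
  rw [tSeq_succ, hd]
  have h4 : 4 * ((m : ℤ) + 1) ^ 2 = (2 * (m : ℤ) + 1 + 1) ^ 2 := by ring
  rw [h4]
  set q : ℤ := 2 * (m : ℤ) + 1
  refine Int.modEq_iff_dvd.2 ⟨(1 + 2 * q) * u - 2 * (k + b) - tSeq m - d ^ 2, ?_⟩
  linear_combination (1 + 2 * q) * hu - 2 * q * hb - 2 * q * hk

theorem oddProd_two_mul_add_one (m : ℕ) :
    oddProd (2 * m + 1) = (2 * m + 1) *
      (oddProd m * ∏ j ∈ range m, ((2 * m + 1 : ℤ) + 2 * ((j : ℤ) + 1))) := by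
  rw [show 2 * m + 1 = m + 1 + m by ring]
  conv_lhs => rw [oddProd, prod_range_add]
  rw [← oddProd, oddProd_succ, mul_right_comm, mul_comm]
  congr 2
  refine prod_congr rfl fun j _ => ?_
  push_cast
  ring

theorem prod_add_two_mul_modEq (q : ℤ) (m : ℕ) :
    ∏ j ∈ range m, (q + 2 * ((j : ℤ) + 1)) ≡ 2 ^ m * m.factorial [ZMOD q] := by
  have : (2 : ℤ) ^ m * m.factorial = ∏ j ∈ range m, (2 * ((j : ℤ) + 1)) := by
    rw [prod_mul_distrib, prod_const, card_range, cast_factorial_eq_prod]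
  rw [this]
  exact Int.ModEq.prod fun j _ => Int.modEq_iff_dvd.2 ⟨-1, by ring⟩

/-- Both terms of `tSeq_succ` contain p², so the cofactors matter only modulo p: t_{p-1} ≡ (-1)^m,
and the odd product divided by p is ≡ (2m)! ≡ -1. -/
theorem tSeq_prime_modEq {m : ℕ} (hp : (2 * m + 1).Prime) :
    tSeq (2 * m + 1) ≡ (1 + 4 * (-1) ^ m) * (2 * (m : ℤ) + 1) ^ 2
      [ZMOD (2 * (m : ℤ) + 1) ^ 3] := by
  obtain ⟨b, hb⟩ := exists_four_pow_eq hp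
  obtain ⟨k, hk⟩ := (factorial_pred_modEq_neg_one hp).symm.dvd
  obtain ⟨u, hu⟩ := (tSeq_two_mul_modEq hp).dvd
  obtain ⟨v, hv⟩ := (prod_add_two_mul_modEq (2 * (m : ℤ) + 1) m).dvd
  rw [add_tsub_cancel_right] at hk
  push_cast at hk
  have hF : ((2 * m).factorial : ℤ) = -1 + (2 * (m : ℤ) + 1) * k := by linear_combination hk
  rw [hF, hb] at hu
  have hodd := factorial_two_mul m
  rw [hF] at hodd
  rw [tSeq_succ, oddProd_two_mul_add_one]
  push_cast
  set q : ℤ := 2 * (m : ℤ) + 1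
  set P : ℤ := ∏ j ∈ range m, (q + 2 * ((j : ℤ) + 1))
  have hP : oddProd m * P = -1 + q * (k - oddProd m * v) := by
    linear_combination -hodd - oddProd m * hv
  rw [hP]
  refine Int.modEq_iff_dvd.2 ⟨4 * u * q - 4 * (-1) ^ m * (2 + 2 * b + q * (k + 1) ^ 2
    - 2 * (k + 1)) + 2 * (k - oddProd m * v) - q * (k - oddProd m * v) ^ 2, ?_⟩
  linear_combination 4 * q ^ 2 * hu

/-! ### The value at (p-3)/4 modulo p. -/

/-- Here -2(m-n) ≡ 2n+1, since 2m ≡ -1. -/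
theorem two_pow_mul_factorial_mul_choose_modEq (m n : ℕ) :
    2 ^ n * (n.factorial : ℤ) * ((-1) ^ n * m.choose n) ≡ oddProd n [ZMOD 2 * (m : ℤ) + 1] := by
  induction n with
  | zero => simp [oddProd]
  | succ n ih =>
    rw [oddProd_succ, Nat.factorial_succ]
    have h1 := cast_choose_succ_mul m n
    refine Int.ModEq.trans ?_ (ih.mul_right _)
    refine Int.modEq_iff_dvd.2 ⟨2 ^ n * n.factorial * (-1) ^ n * m.choose n, ?_⟩
    push_cast
    linear_combination 2 ^ (n + 1) * (n.factorial : ℤ) * (-1) ^ n * h1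

theorem tSeq_modEq_sum_choose_sq (m n : ℕ) :
    tSeq n ≡ 4 ^ n * (n.factorial : ℤ) ^ 2 * ∑ k ∈ range (n + 1), (m.choose k : ℤ) ^ 2
      [ZMOD 2 * (m : ℤ) + 1] := by
  refine tSeq_modEq_sum (fun k => ?_) n
  refine Int.ModEq.trans (congrArg (· % _) ?_) ((two_pow_mul_factorial_mul_choose_modEq m k).pow 2)
  have h4 : (4 : ℤ) ^ k = (2 ^ k) ^ 2 := by rw [← pow_mul, mul_comm, pow_mul]; norm_num
  have hs : ((-1 : ℤ) ^ k) ^ 2 = 1 := by rw [← pow_mul, mul_comm, pow_mul]; norm_num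
  rw [h4]
  linear_combination (-((2 : ℤ) ^ k) ^ 2 * (k.factorial : ℤ) ^ 2 * (m.choose k : ℤ) ^ 2) * hs

theorem two_mul_sum_range_choose_sq (r : ℕ) :
    2 * ∑ k ∈ range (r + 1), (2 * r + 1).choose k ^ 2 = (2 * (2 * r + 1)).choose (2 * r + 1) := by
  rw [← Nat.sum_range_choose_sq, show 2 * r + 1 + 1 = r + 1 + (r + 1) by ring,
    sum_range_add _ (r + 1) (r + 1), two_mul]
  congr 1
  rw [← sum_range_reflect (fun k => (2 * r + 1).choose k ^ 2)]
  refine sum_congr rfl fun k hk => ?_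
  have := mem_range.1 hk
  rw [← Nat.choose_symm (show r + 1 - 1 - k ≤ 2 * r + 1 by omega)]
  congr 2
  omega

/-- With m = 2r+1 odd, m!² ≡ 1 and C(2m,m) ≡ -1, so the half sum S has 2S ≡ -1 and 2t_r ≡ -4^r r!².
-/
theorem choose_mul_tSeq_sq_modEq_one {r : ℕ} (hp : (4 * r + 3).Prime) :
    ((2 * r + 1).choose r * tSeq r) ^ 2 ≡ 1 [ZMOD (4 * r + 3 : ℕ)] := by
  have hpm : 4 * r + 3 = 2 * (2 * r + 1) + 1 := by ring
  have hq : ((4 * r + 3 : ℕ) : ℤ) = 2 * ((2 * r + 1 : ℕ) : ℤ) + 1 := by push_cast; ring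
  have ht := tSeq_modEq_sum_choose_sq (2 * r + 1) r
  have hp' := hp
  rw [hpm] at hp'
  have hF := factorial_pred_modEq_neg_one hp
  rw [show 4 * r + 3 - 1 = 2 * (2 * r + 1) by omega] at hF
  have hM : ((2 * (2 * r + 1)).factorial : ℤ) ≡ -((2 * r + 1).factorial : ℤ) ^ 2
      [ZMOD (4 * r + 3 : ℕ)] := by
    obtain ⟨b, hb⟩ := exists_four_pow_eq hp'
    obtain ⟨u, hu⟩ := (factorial_two_mul_modEq hp').dvd
    rw [hb, pow_succ, pow_mul] at hu
    rw [hq]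
    refine Int.modEq_iff_dvd.2 ⟨(2 * ((2 * r + 1 : ℕ) : ℤ) + 1) * u +
      ((2 * r + 1).factorial : ℤ) ^ 2 * (2 * b), ?_⟩
    norm_num at hu ⊢
    linear_combination hu
  have hMF := Nat.choose_mul_factorial_mul_factorial
    (show 2 * r + 1 ≤ 2 * (2 * r + 1) by omega)
  rw [show 2 * (2 * r + 1) - (2 * r + 1) = 2 * r + 1 by omega,
    ← two_mul_sum_range_choose_sq] at hMF
  have hC := Nat.choose_mul_factorial_mul_factorial (show r ≤ 2 * r + 1 by omega)
  rw [show 2 * r + 1 - r = r + 1 by omega, Nat.factorial_succ r] at hC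
  obtain ⟨b, hb⟩ := exists_four_pow_eq hp'
  rw [← hq] at ht hb
  have h0 : (((4 * r + 3 : ℕ) : ℤ) : ZMod (4 * r + 3)) = 0 := by
    rw [Int.cast_natCast, ZMod.natCast_self]
  have hb' := congrArg (Int.cast : ℤ → ZMod (4 * r + 3)) hb
  have hMF' := congrArg (Nat.cast : ℕ → ZMod (4 * r + 3)) hMF
  have hC' := congrArg (Nat.cast : ℕ → ZMod (4 * r + 3)) hC
  rw [← ZMod.intCast_eq_intCast_iff] at ht hF hM ⊢
  push_cast at ht hF hM h0 hb' hMF' hC' ⊢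
  rw [h0, zero_mul, add_zero] at hb'
  set S := ∑ k ∈ range (r + 1), ((2 * r + 1).choose k : ZMod (4 * r + 3)) ^ 2
  set M := ((2 * r + 1).factorial : ZMod (4 * r + 3))
  set C := ((2 * r + 1).choose r : ZMod (4 * r + 3))
  set R := (r.factorial : ZMod (4 * r + 3))
  set x := (r : ZMod (4 * r + 3))
  have hM1 : M ^ 2 = 1 := by linear_combination hM - hF
  have hS : 2 * S = -1 := by linear_combination hMF' + hF - 2 * S * hM1
  have h2t : 2 * (tSeq r : ZMod (4 * r + 3)) = -(4 ^ r * R ^ 2) := by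
    rw [ht]; linear_combination 4 ^ r * R ^ 2 * hS
  have hx : 4 * (x + 1) = 1 := by linear_combination h0
  have h16 : 4 * ((4 : ZMod (4 * r + 3)) ^ r) ^ 2 = 1 := by rw [← hb']; ring
  -- Inserting (4(r+1))² = 1 completes C·r!² to C·r!·(r+1)! = m!.
  calc (C * (tSeq r : ZMod (4 * r + 3))) ^ 2
      = (4 * (x + 1)) ^ 2 * (C * (tSeq r : ZMod (4 * r + 3))) ^ 2 := by rw [hx]; ring
    _ = 4 * (x + 1) ^ 2 * C ^ 2 * (2 * (tSeq r : ZMod (4 * r + 3))) ^ 2 := by ring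
    _ = 4 * ((4 : ZMod (4 * r + 3)) ^ r) ^ 2 * (C * R * ((x + 1) * R)) ^ 2 := by rw [h2t]; ring
    _ = 1 := by rw [h16, hC', hM1, one_mul]

theorem RatModEq.of_mul_modEq {p : ℕ} (hp : p.Prime) {c : ℕ} {t e : ℤ} (hc : ¬ p ∣ c)
    (h : c * t ≡ e [ZMOD p]) : RatModEq p 1 t (e / c) := by
  obtain ⟨a, ha⟩ := h.symm.dvd
  have hc0 : (c : ℚ) ≠ 0 := by
    intro h0
    exact hc (by simp [Nat.cast_eq_zero.1 h0])
  refine (ratModEq_iff hp).2 ⟨a * (c : ℚ)⁻¹,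
    mul_mem (intCast_mem _ _) (inv_natCast_mem_integralAt hp hc), ?_⟩
  have ha' : (c : ℚ) * t - e = p * a := by exact_mod_cast ha
  field_simp
  linear_combination ha'

theorem tSeq_ratModEq_inv_choose {r : ℕ} (hp : (4 * r + 3).Prime) :
    RatModEq (4 * r + 3) 1 (tSeq r : ℚ) (1 / ((2 * r + 1).choose r : ℚ)) ∨
      RatModEq (4 * r + 3) 1 (tSeq r : ℚ) (-(1 / ((2 * r + 1).choose r : ℚ))) := by
  have hc : ¬ 4 * r + 3 ∣ (2 * r + 1).choose r := fun h =>
    absurd ((hp.dvd_factorial).1 (h.trans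
      (Dvd.intro _ ((mul_assoc _ _ _).symm.trans
        (Nat.choose_mul_factorial_mul_factorial (show r ≤ 2 * r + 1 by omega)))))) (by omega)
  have hd := (choose_mul_tSeq_sq_modEq_one hp).symm.dvd
  rw [show ((2 * r + 1).choose r * tSeq r) ^ 2 - 1 =
    ((2 * r + 1).choose r * tSeq r - 1) * ((2 * r + 1).choose r * tSeq r - -1) by ring] at hd
  rcases (Nat.prime_iff_prime_int.1 hp).dvd_or_dvd hd with h | h
  · left
    simpa using RatModEq.of_mul_modEq hp hc (Int.modEq_iff_dvd.2 h).symm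
  · right
    simpa [neg_div] using RatModEq.of_mul_modEq hp hc (Int.modEq_iff_dvd.2 h).symm

/-! ### Assembly. -/

theorem theorem3p3 (p : ℕ) (hp : p.Prime) (hodd : Odd p) :
    (tSeq p ≡ (1 + 4 * (-1) ^ ((p - 1) / 2)) * (p : ℤ) ^ 2 [ZMOD (p : ℤ) ^ 3]) ∧
    RatModEq p 2 (tSeq (p - 1) : ℚ)
      ((-1) ^ ((p - 1) / 2) *
        (2 * (p : ℚ) + 2 ^ p - 2 + ((p : ℚ) * bernoulli (p - 1)) ^ 2)) ∧
    RatModEq p 2 (tSeq ((p - 1) / 2) : ℚ)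
      ((p : ℚ) * bernoulli (p - 1) - (p : ℚ) + 2 ^ (p - 1) - 1) ∧
    RatModEq p 2 (tSeq ((p + 1) / 2) : ℚ)
      ((p : ℚ) * bernoulli (p - 1) - 3 * (p : ℚ) + 2 ^ (p - 1) - 1) ∧
    (p % 4 = 3 →
      RatModEq p 1 (tSeq ((p - 3) / 4) : ℚ)
        (1 / (Nat.choose ((p - 1) / 2) ((p - 3) / 4) : ℚ)) ∨
      RatModEq p 1 (tSeq ((p - 3) / 4) : ℚ)
        (-(1 / (Nat.choose ((p - 1) / 2) ((p - 3) / 4) : ℚ)))) := by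
  have hG := (RatModEq.of_int hp (factorial_pred_add_prime_modEq_sum_pow hp hodd)).trans hp
    (sum_pow_ratModEq_mul_bernoulli hp hodd)
  obtain ⟨m, rfl⟩ := hodd
  rw [show (2 * m + 1 - 1) / 2 = m by omega, show (2 * m + 1 + 1) / 2 = m + 1 by omega]
  obtain ⟨z, hz, hzeq⟩ := (ratModEq_iff hp).1 hG
  have hp0 : (2 * m + 1 : ℕ) - 1 = 2 * m := rfl
  have h4 : (2 : ℚ) ^ (2 * m) = 4 ^ m := by rw [pow_mul]; norm_num
  have h4' : (2 : ℚ) ^ (2 * m + 1) = 2 * 4 ^ m := by rw [pow_succ, h4, mul_comm]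
  rw [hp0] at hzeq ⊢
  rw [h4, h4']
  set x : ℚ := ((2 * m + 1 : ℕ) : ℚ) * bernoulli (2 * m)
  -- Needed for the squared term: with G = (2m)! + p, G² - x² = (G-x)(G+x) requires G+x integral at
  -- p.
  have hx : x ∈ integralAt _ hp := by
    have : x = (((2 * m).factorial + (2 * m + 1 : ℕ) : ℤ) : ℚ) -
      ((2 * m + 1 : ℕ) : ℚ) ^ 2 * z := by linear_combination -hzeq
    rw [this]
    exact sub_mem (intCast_mem _ _) (mul_mem (pow_mem (natCast_mem _ _) _) hz)
  refine ⟨?_, ?_, ?_, ?_, fun h => ?_⟩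
  · exact_mod_cast tSeq_prime_modEq hp
  · refine (RatModEq.of_int (k := 2) hp (by exact_mod_cast tSeq_two_mul_modEq hp)).trans hp
      ((ratModEq_iff hp).2 ⟨(-1) ^ m * z *
        ((((2 * m).factorial + (2 * m + 1 : ℕ) : ℤ) : ℚ) + x),
        mul_mem (mul_mem (pow_mem (neg_mem (one_mem _)) _) hz)
          (add_mem (intCast_mem _ _) hx), ?_⟩)
    push_cast at hzeq ⊢
    linear_combination (-1) ^ m * ((2 * m).factorial + (2 * m + 1) + x) * hzeq
  · refine (RatModEq.of_int (k := 2) hp (by exact_mod_cast tSeq_half_modEq hp)).trans hp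
      ((ratModEq_iff hp).2 ⟨z, hz, ?_⟩)
    push_cast at hzeq ⊢
    linear_combination hzeq
  · refine (RatModEq.of_int (k := 2) hp (by exact_mod_cast tSeq_half_succ_modEq hp)).trans hp
      ((ratModEq_iff hp).2 ⟨z, hz, ?_⟩)
    push_cast at hzeq ⊢
    linear_combination hzeq
  · obtain ⟨r, hr⟩ : ∃ r, m = 2 * r + 1 := ⟨(m - 1) / 2, by omega⟩
    subst hr
    rw [show (2 * (2 * r + 1) + 1 - 3) / 4 = r by omega]
    rw [show 2 * (2 * r + 1) + 1 = 4 * r + 3 by ring] at hp ⊢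
    exact tSeq_ratModEq_inv_choose hp
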